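/- Let $T>0$, let $C_0[0,T]$ be the space of real-valued continuous functions $x$ on $[0,T]$ with $x(0)=0$, and let $m$ be Wiener measure on it (completed). A set $N\subset C_0[0,T]$ is scale-invariant null if $m(\rho N)=0$ for all $\rho>0$, and a property holds s-a.e. if it holds off such a set. A functional $H:C_0[0,T]\to\mathbb C$ is scale-invariant measurable if $\rho H^{-1}(B)$ is Wiener measurable for every Borel set $B\subset\mathbb C$ and every $\rho>0$. For $v\in L_2[0,T]$ let $\langle v,x\rangle=\lim_{N\to\infty}\sum_{k<N}(v,\varphi_k)_2\int_0^T\varphi_k(t)\,dx(t)$ be the Paley–Wiener–Zygmund stochastic integral, where $\{\varphi_k\}$ is any fixed complete orthonormal sequence in $L_2[0,T]$ of functions of bounded variation ($\langle v,x\rangle:=0$ on the scale-invariant null set where the limit fails to exist). Let $\mathbb C_+=\{\lambda\in\mathbb C:\operatorname{Re}\lambda>0\}$. For a scale-invariant measurable functional $H$ such that $J(\lambda)=\int_{C_0[0,T]}H(\lambda^{-1/2}x)\,m(dx)$ exists as a finite number for all $\lambda>0$, the analytic Wiener integral $\int^{\mathrm{anw}_\lambda}H(x)\,m(dx)$, $\lambda\in\mathbb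 C_+$, is the analytic function on $\mathbb C_+$ that agrees with $J$ on $(0,\infty)$, if there is one. For real $q\ne0$, the $L_1$ analytic Fourier–Feynman transform of $F$ is $$T_q^{(1)}(F)(y)=\lim_{\lambda\to-iq,\ \lambda\in\mathbb C_+}\int^{\mathrm{anw}_\lambda}F(y+x)\,m(dx)\qquad\text{for s-a.e. }y ;$$ it exists if for s-a.e. $y$ these analytic Wiener integrals and this limit exist. Theorem. Let $\alpha_1,\dots,\alpha_n$ be orthonormal in $L_2[0,T]$, let $p_1,\dots,p_n$ be nonnegative integers, and let $F(x)=\prod_{j=1}^n\langle\alpha_j,x\rangle^{2p_j}$. Then for every nonzero real number $q$ the transform $T_q^{(1)}(F)$ exists and $$T_q^{(1)}(F)(y)=\prod_{j=1}^n\left[\sum_{s=0}^{p_j}\binom{2p_j}{2s}(2s-1)!!\left(\frac iq\right)^s\langle\alpha_j,y\rangle^{2p_j-2s}\right]\qquad\text{for s-a.e. }y\in C_0[0,T],$$ where $(-1)!!=1$. -/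

import Mathlib

open MeasureTheory ProbabilityTheory Filter Topology

/-- The space `C₀[0,T]` of real-valued continuous functions on `[0,T]` vanishing at `0`,
with the supremum norm. -/
abbrev C0 (T : ℝ) : Submodule ℝ C(Set.Icc (0 : ℝ) T, ℝ) where
  carrier := {x | ∀ t : Set.Icc (0 : ℝ) T, (t : ℝ) = 0 → x t = 0}
  add_mem' := by
    intro x y hx hy t ht
    simp [hx t ht, hy t ht]
  zero_mem' := by
    intro t _
    rfl
  smul_mem' := by
    intro c x hx t ht
    simp [hx t ht]

/-- `C₀[0,T]` carries its Borel σ-algebra. -/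
noncomputable instance C0.instMeasurableSpace (T : ℝ) : MeasurableSpace (C0 T) := borel (C0 T)

instance C0.instBorelSpace (T : ℝ) : BorelSpace (C0 T) := ⟨rfl⟩

/-- `m` is Wiener measure on (the Borel sets of) `C₀[0,T]`: under `m`, the coordinate process
`x ↦ x(t)` is a Gaussian process with mean `0` and covariance `min s t`. These
finite-dimensional distributions determine `m`. The complete measure of the text is the completion
of `m`; its measurable sets are the sets that are `NullMeasurableSet` for `m`. -/
structure IsWienerMeasure {T : ℝ} (m : Measure (C0 T)) : Prop where
  isGaussianProcess :
    IsGaussianProcess (fun (t : Set.Icc (0 : ℝ) T) (x : C0 T) => (x : C(Set.Icc (0 : ℝ) T, ℝ)) t) m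
  mean_eq_zero : ∀ t : Set.Icc (0 : ℝ) T, ∫ x : C0 T, (x : C(Set.Icc (0 : ℝ) T, ℝ)) t ∂m = 0
  covariance_eq : ∀ s t : Set.Icc (0 : ℝ) T,
    ∫ x : C0 T, (x : C(Set.Icc (0 : ℝ) T, ℝ)) s * (x : C(Set.Icc (0 : ℝ) T, ℝ)) t ∂m
      = min (s : ℝ) (t : ℝ)

/-- `B` is scale-invariant measurable: `ρB` is Wiener measurable for all `ρ > 0`. -/
def ScaleInvMeasurableSet {T : ℝ} (m : Measure (C0 T)) (B : Set (C0 T)) : Prop :=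
  ∀ ρ : ℝ, 0 < ρ → NullMeasurableSet ((fun x : C0 T => ρ • x) '' B) m

/-- A complex functional is scale-invariant measurable if the preimages of all Borel sets are
scale-invariant measurable. -/
def ScaleInvMeasurable {T : ℝ} (m : Measure (C0 T)) (F : C0 T → ℂ) : Prop :=
  ∀ s : Set ℂ, MeasurableSet s → ScaleInvMeasurableSet m (F ⁻¹' s)

/-- `N` is scale-invariant null: scale-invariant measurable, and `m (ρN) = 0` for all `ρ > 0`. -/
def ScaleInvNull {T : ℝ} (m : Measure (C0 T)) (N : Set (C0 T)) : Prop :=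
  ScaleInvMeasurableSet m N ∧ ∀ ρ : ℝ, 0 < ρ → m ((fun x : C0 T => ρ • x) '' N) = 0

/-- The property `P` holds scale-invariant almost everywhere (s-a.e.). -/
def ScaleInvAE {T : ℝ} (m : Measure (C0 T)) (P : C0 T → Prop) : Prop :=
  ∃ N : Set (C0 T), ScaleInvNull m N ∧ ∀ y, y ∉ N → P y

/-- `I` is the Riemann–Stieltjes integral `∫₀ᵀ f(t) dx(t)`: the limit of the Riemann–Stieltjes
sums over tagged partitions `0 = t₀ ≤ t₁ ≤ ⋯ ≤ tₙ = T`, `ξᵢ ∈ [tᵢ, tᵢ₊₁]`,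
as the mesh tends to `0`. -/
def HasRiemannStieltjesIntegral {T : ℝ} (f : Set.Icc (0 : ℝ) T → ℝ) (x : C0 T) (I : ℝ) : Prop :=
  ∀ ε : ℝ, 0 < ε → ∃ δ : ℝ, 0 < δ ∧ ∀ (n : ℕ) (t ξ : ℕ → Set.Icc (0 : ℝ) T),
    (t 0 : ℝ) = 0 → (t n : ℝ) = T →
    (∀ i < n, t i ≤ ξ i ∧ ξ i ≤ t (i + 1) ∧ (t (i + 1) : ℝ) - (t i : ℝ) < δ) →
    |∑ i ∈ Finset.range n, f (ξ i) * ((x : C(Set.Icc (0 : ℝ) T, ℝ)) (t (i + 1))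
        - (x : C(Set.Icc (0 : ℝ) T, ℝ)) (t i)) - I| < ε

open Classical in
/-- The Riemann–Stieltjes integral `∫₀ᵀ f(t) dx(t)` (`0` if it does not exist; it always exists
for `f` of bounded variation). -/
noncomputable def riemannStieltjes {T : ℝ} (f : Set.Icc (0 : ℝ) T → ℝ) (x : C0 T) : ℝ :=
  if h : ∃ I, HasRiemannStieltjesIntegral f x I then h.choose else 0

/-- Lebesgue measure on `[0,T]`. -/
noncomputable abbrev lebesgueIcc (T : ℝ) : Measure (Set.Icc (0 : ℝ) T) :=
  Measure.comap ((↑) : Set.Icc (0 : ℝ) T → ℝ) volume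

/-- The real Hilbert space `L₂[0,T]`. -/
abbrev L2 (T : ℝ) : Type := Lp ℝ 2 (lebesgueIcc T)

/-- A complete orthonormal sequence in `L₂[0,T]` together with representatives that are
functions of bounded variation on `[0,T]`. -/
structure BVBasis (T : ℝ) where
  basis : HilbertBasis ℕ ℝ (L2 T)
  fn : ℕ → Set.Icc (0 : ℝ) T → ℝ
  fn_ae_eq : ∀ k, fn k =ᵐ[lebesgueIcc T] basis k
  fn_bv : ∀ k, BoundedVariationOn (fn k) Set.univ

/-- `c` is the Paley–Wiener–Zygmund integral `⟨v,x⟩ = lim_n ∫₀ᵀ ∑_{k<n} (v,φₖ)₂ φₖ(t) dx(t)`. -/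
def HasPWZIntegral {T : ℝ} (φ : BVBasis T) (v : L2 T) (x : C0 T) (c : ℝ) : Prop :=
  Tendsto (fun n : ℕ => ∑ k ∈ Finset.range n, inner ℝ v (φ.basis k) * riemannStieltjes (φ.fn k) x)
    atTop (𝓝 c)

open Classical in
/-- The Paley–Wiener–Zygmund stochastic integral `⟨v,x⟩`, with the value `0` for those `x` for
which the limit does not exist (a scale-invariant null set). -/
noncomputable def pwz {T : ℝ} (φ : BVBasis T) (v : L2 T) (x : C0 T) : ℝ :=
  if h : ∃ c, HasPWZIntegral φ v x c then h.choose else 0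

/-- The open right half-plane `ℂ₊`. -/
def rightHalfPlane : Set ℂ := {z | 0 < z.re}

/-- `J` is the analytic Wiener integral of `F` as a function of its parameter `λ ∈ ℂ₊`: `F` is
scale-invariant measurable, `∫ F(λ^{-1/2} x) m(dx)` exists as a finite number for all `λ > 0`, and
`J` is an analytic function on `ℂ₊` which agrees with it for all `λ > 0`. -/
structure IsAnalyticWienerIntegral {T : ℝ} (m : Measure (C0 T)) (F : C0 T → ℂ) (J : ℂ → ℂ) :
    Prop where
  measurable : ScaleInvMeasurable m F
  integrable : ∀ l : ℝ, 0 < l → Integrable (fun x : C0 T => F ((Real.sqrt l)⁻¹ • x)) m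
  analytic : AnalyticOnNhd ℂ J rightHalfPlane
  eq_integral : ∀ l : ℝ, 0 < l → J (l : ℂ) = ∫ x : C0 T, F ((Real.sqrt l)⁻¹ • x) ∂m

/-- `c` is the analytic Feynman integral of `F` with parameter `q`: the limit of the analytic
Wiener integral as `λ → -iq` within `ℂ₊`. -/
def HasAnalyticFeynmanIntegral {T : ℝ} (m : Measure (C0 T)) (q : ℝ) (F : C0 T → ℂ) (c : ℂ) :
    Prop :=
  ∃ J : ℂ → ℂ, IsAnalyticWienerIntegral m F J ∧
    Tendsto J (𝓝[rightHalfPlane] (-Complex.I * (q : ℂ))) (𝓝 c)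

/-- The `L₁` analytic Fourier–Feynman transform `T_q^{(1)}(F)` exists and equals `G` s-a.e.: for
s-a.e. `y`, the analytic Wiener integrals `T_λ(F)(y)` of `x ↦ F(y + x)` exist for all `λ ∈ ℂ₊`
and tend to `G(y)` as `λ → -iq` within `ℂ₊`. -/
def HasL1FourierFeynmanTransform {T : ℝ} (m : Measure (C0 T)) (q : ℝ) (F G : C0 T → ℂ) : Prop :=
  ScaleInvAE m fun y => HasAnalyticFeynmanIntegral m q (fun x => F (y + x)) (G y)

/-- The polynomial functional `F(x) = ∏ⱼ ⟨αⱼ,x⟩^{2pⱼ}`. -/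
noncomputable def polyFunctional {T : ℝ} (φ : BVBasis T) {n : ℕ} (α : Fin n → L2 T)
    (p : Fin n → ℕ) (x : C0 T) : ℂ :=
  ∏ j, (pwz φ (α j) x : ℂ) ^ (2 * p j)

/-! Under Wiener measure the integrals `⟨αⱼ,x⟩` of an orthonormal family are independent standard
normal variables (`IsWienerMeasure.map_pwz`). Where the defining series converge, `⟨αⱼ, y +
λ^{-1/2}x⟩ = ⟨αⱼ,y⟩ + λ^{-1/2}⟨αⱼ,x⟩`, so the Wiener integral of `F(y + λ^{-1/2}x)` factors into
one-dimensional moments `E(a + λ^{-1/2}g)^{2p}` with `g` standard normal. The odd moments of `g`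
vanish, so each factor is a polynomial in `λ⁻¹` (`integral_shift_pow`). It continues to all of `ℂ₊`,
and letting `λ → -iq` replaces `λ⁻¹` by `i/q`.

The main work is the normal law. Riemann–Stieltjes sums of the basis functions are linear in
Gaussian increments, and their variances are Riemann sums of `(∑ aₖφₖ)²`; orthonormality makes the
integrals `∫ φₖ dx` independent standard normal. The series for `⟨v,x⟩` then converges almost surely
by martingale convergence, and Parseval identifies its law. The convergence set is invariant under
scaling, so its complement is scale-invariant null, which is what turns "a.e." into "s-a.e.". -/

section RiemannStieltjes

/-! ### Riemann–Stieltjes integration of functions of bounded variation against continuous paths. -/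

variable {T : ℝ}

/-- The Riemann–Stieltjes sum of `f` against `x`. -/
def rsSum (f x : Set.Icc (0 : ℝ) T → ℝ) (n : ℕ) (t ξ : ℕ → Set.Icc (0 : ℝ) T) : ℝ :=
  ∑ i ∈ Finset.range n, f (ξ i) * (x (t (i + 1)) - x (t i))

/-- A tagged partition of `[0,T]` with mesh less than `δ`. -/
structure IsTaggedPartition (δ : ℝ) (n : ℕ) (t ξ : ℕ → Set.Icc (0 : ℝ) T) : Prop where
  zero : (t 0 : ℝ) = 0
  last : (t n : ℝ) = T
  tag : ∀ i < n, t i ≤ ξ i ∧ ξ i ≤ t (i + 1) ∧ (t (i + 1) : ℝ) - (t i : ℝ) < δ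

/-- The signed variation from a base point serves as `W`. Later estimates use only `W`, whose
increments telescope. -/
lemma BoundedVariationOn.exists_monotone_majorant {α : Type*} [LinearOrder α] {f : α → ℝ}
    (hf : BoundedVariationOn f Set.univ) :
    ∃ W : α → ℝ, Monotone W ∧ ∀ a b, a ≤ b → |f b - f a| ≤ W b - W a := by
  rcases isEmpty_or_nonempty α with h | ⟨⟨c⟩⟩
  · exact ⟨f, fun a => (h.false a).elim, fun a => (h.false a).elim⟩
  have hl := hf.locallyBoundedVariationOn
  refine ⟨variationOnFromTo f Set.univ c,
    monotoneOn_univ.1 (variationOnFromTo.monotoneOn hl (Set.mem_univ c)), fun a b hab => ?_⟩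
  exact variationOnFromTo.abs_sub_le_sub_of_le hl (Set.mem_univ c) (Set.mem_univ a)
    (Set.mem_univ b) hab

lemma abs_le_of_majorant (hT : 0 ≤ T) {f W : Set.Icc (0 : ℝ) T → ℝ} (hW : Monotone W)
    (hfW : ∀ a b, a ≤ b → |f b - f a| ≤ W b - W a) (s : Set.Icc (0 : ℝ) T) :
    |f s| ≤ |f ⟨0, ⟨le_rfl, hT⟩⟩| + (W ⟨T, ⟨hT, le_rfl⟩⟩ - W ⟨0, ⟨le_rfl, hT⟩⟩) := by
  have h1 := hfW ⟨0, ⟨le_rfl, hT⟩⟩ s s.2.1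
  have h2 : W s ≤ W ⟨T, ⟨hT, le_rfl⟩⟩ := hW s.2.2
  have h3 := abs_sub_abs_le_abs_sub (f s) (f ⟨0, ⟨le_rfl, hT⟩⟩)
  linarith

/-- Both `W` and `W - f` are monotone, and `f` is their difference. -/
lemma measurable_of_majorant {f W : Set.Icc (0 : ℝ) T → ℝ} (hW : Monotone W)
    (hfW : ∀ a b, a ≤ b → |f b - f a| ≤ W b - W a) : Measurable f := by
  have h : Monotone (W - f) := fun a b hab => by
    have := (abs_le.1 (hfW a b hab)).2
    simp only [Pi.sub_apply]; linarith
  have := hW.measurable.sub h.measurable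
  simpa using this

/-- Summation by parts: the differences move from the rough path `x` to `f`, whose variation is
finite. -/
lemma rsSum_succ_eq (f x : Set.Icc (0 : ℝ) T → ℝ) (n : ℕ) (t ξ : ℕ → Set.Icc (0 : ℝ) T) :
    rsSum f x (n + 1) t ξ = f (ξ n) * x (t (n + 1)) - f (ξ 0) * x (t 0)
      - ∑ i ∈ Finset.range n, (f (ξ (i + 1)) - f (ξ i)) * x (t (i + 1)) := by
  unfold rsSum
  induction n with
  | zero => simp; ring
  | succ n ih => rw [Finset.sum_range_succ, ih, Finset.sum_range_succ _ n]; ring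

/-- After summation by parts the two boundary terms cost `K * ε` each, and the telescoping
increments of `W` cost `C * ε`. The bound depends on `x` only through its supremum and not at all on
the mesh. -/
lemma abs_rsSum_le {f W x : Set.Icc (0 : ℝ) T → ℝ} {K ε C δ : ℝ}
    (hfW : ∀ a b, a ≤ b → |f b - f a| ≤ W b - W a) (hK : ∀ s, |f s| ≤ K)
    (hC : ∀ s t, W s - W t ≤ C) (hx : ∀ s, |x s| ≤ ε) {n : ℕ}
    {t ξ : ℕ → Set.Icc (0 : ℝ) T} (h : IsTaggedPartition δ n t ξ) :
    |rsSum f x n t ξ| ≤ ε * (2 * K + C) := by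
  have hε : 0 ≤ ε := (abs_nonneg _).trans (hx (t 0))
  have hK0 : 0 ≤ K := (abs_nonneg _).trans (hK (t 0))
  have hC0 : 0 ≤ C := by simpa using hC (t 0) (t 0)
  rcases n with _ | n
  · simp only [rsSum, Finset.range_zero, Finset.sum_empty, abs_zero]; positivity
  rw [rsSum_succ_eq]
  have h1 : |∑ i ∈ Finset.range n, (f (ξ (i + 1)) - f (ξ i)) * x (t (i + 1))| ≤ C * ε := by
    calc _ ≤ ∑ i ∈ Finset.range n, (W (ξ (i + 1)) - W (ξ i)) * ε := by
          refine (Finset.abs_sum_le_sum_abs _ _).trans (Finset.sum_le_sum fun i hi => ?_)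
          have hi := Finset.mem_range.1 hi
          rw [abs_mul]
          have h2 := hfW (ξ i) (ξ (i + 1))
            ((h.tag i (by omega)).2.1.trans (h.tag (i + 1) (by omega)).1)
          gcongr
          · exact (abs_nonneg _).trans h2
          · exact hx _
      _ = (W (ξ n) - W (ξ 0)) * ε := by
          rw [← Finset.sum_mul, Finset.sum_range_sub (fun i => W (ξ i))]
      _ ≤ C * ε := by gcongr; exact hC _ _
  have h2 : |f (ξ n) * x (t (n + 1))| ≤ K * ε := by
    rw [abs_mul]; gcongr; exacts [hK _, hx _]
  have h3 : |f (ξ 0) * x (t 0)| ≤ K * ε := by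
    rw [abs_mul]; gcongr; exacts [hK _, hx _]
  rw [abs_le] at *
  constructor <;> nlinarith

/-- On each cell `f` differs from its value at the tag by at most the increment of `W`, and these
increments telescope. `Set.projIcc` extends `f` to the line so that interval integrals apply. -/
lemma rsSum_sub_integral_le (hT : 0 < T) {f W : Set.Icc (0 : ℝ) T → ℝ} (hW : Monotone W)
    (hfW : ∀ a b, a ≤ b → |f b - f a| ≤ W b - W a) {g g' : ℝ → ℝ} {M δ C : ℝ}
    (hg : ∀ s, HasDerivAt g (g' s) s) (hg' : Continuous g')
    (hM : ∀ s ∈ Set.Icc (0 : ℝ) T, |g' s| ≤ M) (hC : ∀ s t, W s - W t ≤ C) {n : ℕ}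
    {t ξ : ℕ → Set.Icc (0 : ℝ) T} (h : IsTaggedPartition δ n t ξ) :
    |rsSum f (fun s => g s) n t ξ - ∫ s in (0 : ℝ)..T, f (Set.projIcc 0 T hT.le s) * g' s|
      ≤ M * δ * C := by
  have hM0 : 0 ≤ M := (abs_nonneg _).trans (hM 0 ⟨le_rfl, hT.le⟩)
  have hC0 : 0 ≤ C := by simpa using hC (t 0) (t 0)
  have hfm : Measurable fun s => f (Set.projIcc 0 T hT.le s) :=
    (measurable_of_majorant hW hfW).comp continuous_projIcc.measurable
  have hint : ∀ a b : ℝ, IntervalIntegrable (fun s => f (Set.projIcc 0 T hT.le s) * g' s) volume a b := by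
    intro a b
    refine IntervalIntegrable.mul_continuousOn ?_ hg'.continuousOn
    refine (intervalIntegrable_const (c := |f ⟨0, ⟨le_rfl, hT.le⟩⟩| +
      (W ⟨T, ⟨hT.le, le_rfl⟩⟩ - W ⟨0, ⟨le_rfl, hT.le⟩⟩))).mono_fun hfm.aestronglyMeasurable
      (Eventually.of_forall fun s => ?_)
    exact (abs_le_of_majorant hT.le hW hfW _).trans (le_abs_self _)
  have hsplit : ∫ s in (0 : ℝ)..T, f (Set.projIcc 0 T hT.le s) * g' s
      = ∑ i ∈ Finset.range n,
        ∫ s in (t i : ℝ)..(t (i + 1) : ℝ), f (Set.projIcc 0 T hT.le s) * g' s := by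
    rw [intervalIntegral.sum_integral_adjacent_intervals (a := fun i => (t i : ℝ))
      (fun k _ => hint _ _), h.zero, h.last]
  rw [hsplit, rsSum, ← Finset.sum_sub_distrib]
  have hterm : ∀ i ∈ Finset.range n, |f (ξ i) * (g (t (i + 1)) - g (t i)) -
      ∫ s in (t i : ℝ)..(t (i + 1) : ℝ), f (Set.projIcc 0 T hT.le s) * g' s|
      ≤ M * δ * (W (t (i + 1)) - W (t i)) := by
    intro i hi
    obtain ⟨h1, h2, h3⟩ := h.tag i (Finset.mem_range.1 hi)
    have hle : (t i : ℝ) ≤ t (i + 1) := h1.trans h2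
    have hδ : 0 ≤ δ := by linarith
    have hWd : 0 ≤ W (t (i + 1)) - W (t i) := sub_nonneg.2 (hW (h1.trans h2))
    rw [← intervalIntegral.integral_eq_sub_of_hasDerivAt (fun s _ => hg s)
      (hg'.intervalIntegrable _ _), ← intervalIntegral.integral_const_mul,
      ← intervalIntegral.integral_sub ((hg'.intervalIntegrable _ _).const_mul _) (hint _ _)]
    have := intervalIntegral.norm_integral_le_of_norm_le_const
      (a := (t i : ℝ)) (b := t (i + 1)) (C := (W (t (i + 1)) - W (t i)) * M)
      (f := fun s => f (ξ i) * g' s - f (Set.projIcc 0 T hT.le s) * g' s) ?_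
    · rw [Real.norm_eq_abs, abs_of_nonneg (sub_nonneg.2 hle)] at this
      refine this.trans ?_
      calc _ ≤ (W (t (i + 1)) - W (t i)) * M * δ := by gcongr
        _ = _ := by ring
    · intro s hs
      rw [Set.uIoc_of_le hle] at hs
      have hsI : s ∈ Set.Icc (0 : ℝ) T :=
        ⟨(t i).2.1.trans hs.1.le, hs.2.trans (t (i + 1)).2.2⟩
      rw [← sub_mul, norm_mul, Real.norm_eq_abs, Real.norm_eq_abs, Set.projIcc_of_mem hT.le hsI]
      gcongr
      · have ha : W (t i) ≤ W ⟨s, hsI⟩ := hW hs.1.le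
        have hb : W ⟨s, hsI⟩ ≤ W (t (i + 1)) := hW hs.2
        have hc := hW h1
        have hd := hW h2
        rcases le_total (ξ i) ⟨s, hsI⟩ with hh | hh
        · rw [abs_sub_comm]; linarith [hfW _ _ hh]
        · linarith [hfW _ _ hh]
      · exact hM s hsI
  have hn : 0 < n := by
    rcases Nat.eq_zero_or_pos n with rfl | hn
    · exact absurd (h.last.symm.trans h.zero) hT.ne'
    · exact hn
  obtain ⟨h1, h2, h3⟩ := h.tag 0 hn
  have hle : (t 0 : ℝ) ≤ t (0 + 1) := h1.trans h2
  have hδ : 0 ≤ δ := by linarith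
  refine (Finset.abs_sum_le_sum_abs _ _).trans ((Finset.sum_le_sum hterm).trans ?_)
  rw [← Finset.mul_sum, Finset.sum_range_sub (fun i => W (t i))]
  gcongr
  exact hC _ _

/-- The `i`-th point of the partition of `[0,T]` into `k + 1` intervals of equal length. -/
noncomputable def unifPt (hT : 0 < T) (k i : ℕ) : Set.Icc (0 : ℝ) T :=
  Set.projIcc 0 T hT.le (T * i / (k + 1))

lemma coe_unifPt (hT : 0 < T) {k i : ℕ} (hi : i ≤ k + 1) :
    (unifPt hT k i : ℝ) = T * i / (k + 1) := by
  have hi' : (i : ℝ) ≤ k + 1 := by exact_mod_cast hi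
  have : T * i / (k + 1) ∈ Set.Icc (0 : ℝ) T := by
    refine ⟨by positivity, ?_⟩
    rw [div_le_iff₀ (by positivity)]
    gcongr
  rw [unifPt, Set.projIcc_of_mem hT.le this]

lemma isTaggedPartition_unifPt (hT : 0 < T) {δ : ℝ} {k : ℕ} (hk : T / (k + 1) < δ) :
    IsTaggedPartition δ (k + 1) (unifPt hT k) (unifPt hT k) := by
  refine ⟨?_, ?_, fun i hi => ⟨le_rfl, ?_, ?_⟩⟩
  · rw [coe_unifPt hT (by omega)]; simp
  · rw [coe_unifPt hT le_rfl]; push_cast; field_simp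
  · apply Subtype.coe_le_coe.1
    rw [coe_unifPt hT (by omega), coe_unifPt hT (by omega)]
    gcongr; omega
  · rw [coe_unifPt hT (by omega), coe_unifPt hT (by omega)]
    push_cast
    convert hk using 1
    ring

lemma eventually_isTaggedPartition_unifPt (hT : 0 < T) {δ : ℝ} (hδ : 0 < δ) :
    ∀ᶠ k : ℕ in atTop, IsTaggedPartition δ (k + 1) (unifPt hT k) (unifPt hT k) := by
  have : Tendsto (fun k : ℕ => T / ((k : ℝ) + 1)) atTop (𝓝 0) :=
    tendsto_const_div_atTop_nhds_zero_nat T |>.comp (tendsto_add_atTop_nat 1) |>.congr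
      fun k => by simp
  filter_upwards [this.eventually_lt_const hδ] with k hk
  exact isTaggedPartition_unifPt hT hk

/-- The Riemann–Stieltjes sum of `f` against `x` over the uniform partition. -/
noncomputable def unifSum (hT : 0 < T) (f x : Set.Icc (0 : ℝ) T → ℝ) (k : ℕ) : ℝ :=
  rsSum f x (k + 1) (unifPt hT k) (unifPt hT k)

lemma HasRiemannStieltjesIntegral.tendsto_unifSum (hT : 0 < T) {f : Set.Icc (0 : ℝ) T → ℝ}
    {x : C0 T} {I : ℝ} (h : HasRiemannStieltjesIntegral f x I) :
    Tendsto (unifSum hT f x.1) atTop (𝓝 I) := by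
  rw [Metric.tendsto_nhds]
  intro ε hε
  obtain ⟨δ, hδ, hI⟩ := h ε hε
  filter_upwards [eventually_isTaggedPartition_unifPt hT hδ] with k hk
  exact hI _ _ _ hk.zero hk.last hk.tag

/-- Riemann–Stieltjes sums over partitions of small mesh are close to each other. -/
lemma exists_forall_rsSum_sub_le (hT : 0 < T) {f : Set.Icc (0 : ℝ) T → ℝ}
    (hf : BoundedVariationOn f Set.univ) (x : C0 T) {ε : ℝ} (hε : 0 < ε) :
    ∃ δ > 0, ∃ J : ℝ, ∀ n t ξ, IsTaggedPartition δ n t ξ → |rsSum f x.1 n t ξ - J| < ε := by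
  obtain ⟨W, hW, hfW⟩ := hf.exists_monotone_majorant
  set K := |f ⟨0, ⟨le_rfl, hT.le⟩⟩| + (W ⟨T, ⟨hT.le, le_rfl⟩⟩ - W ⟨0, ⟨le_rfl, hT.le⟩⟩)
  have hK := abs_le_of_majorant hT.le hW hfW
  set C := W ⟨T, ⟨hT.le, le_rfl⟩⟩ - W ⟨0, ⟨le_rfl, hT.le⟩⟩
  have hC : ∀ s t, W s - W t ≤ C := fun s t => by
    have h1 : W s ≤ W ⟨T, ⟨hT.le, le_rfl⟩⟩ := hW s.2.2
    have h2 : W ⟨0, ⟨le_rfl, hT.le⟩⟩ ≤ W t := hW t.2.1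
    linarith
  have hC0 : 0 ≤ C := by simpa using hC ⟨0, ⟨le_rfl, hT.le⟩⟩ ⟨0, ⟨le_rfl, hT.le⟩⟩
  have hK0 : 0 ≤ K := (abs_nonneg _).trans (hK ⟨0, ⟨le_rfl, hT.le⟩⟩)
  -- Weierstrass splits `x` into a polynomial `P` and a uniformly small remainder. The remainder
  -- costs at most `ε / 2` on every partition, and `P` costs less than `ε / 2` at small mesh. The
  -- added `1`s keep the denominators positive.
  obtain ⟨P, hP⟩ := exists_polynomial_near_continuousMap 0 T x.1
    (ε / (2 * (2 * K + C + 1))) (by positivity)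
  obtain ⟨M, hM⟩ := isCompact_Icc.exists_bound_of_continuousOn
    (P.derivative.continuous.continuousOn (s := Set.Icc 0 T))
  have hM0 : 0 ≤ M := (norm_nonneg _).trans (hM 0 ⟨le_rfl, hT.le⟩)
  refine ⟨ε / (2 * (M * C + 1)), by positivity,
    ∫ s in (0 : ℝ)..T, f (Set.projIcc 0 T hT.le s) * P.derivative.eval s, fun n t ξ h => ?_⟩
  have h1 := rsSum_sub_integral_le hT hW hfW (fun s => P.hasDerivAt s) P.derivative.continuous
    hM hC h
  have h2 := abs_rsSum_le (x := fun s => x.1 s - P.eval (s : ℝ))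
    (ε := ε / (2 * (2 * K + C + 1))) hfW hK hC (fun s => ?_) h
  · have h3 : rsSum f (fun s => x.1 s - P.eval (s : ℝ)) n t ξ
        = rsSum f x.1 n t ξ - rsSum f (fun s => P.eval (s : ℝ)) n t ξ := by
      simp only [rsSum, ← Finset.sum_sub_distrib]
      exact Finset.sum_congr rfl fun i _ => by ring
    rw [h3] at h2
    have h4 : M * (ε / (2 * (M * C + 1))) * C < ε / 2 := by
      have : M * (ε / (2 * (M * C + 1))) * C = ε / 2 * (M * C / (M * C + 1)) := by field_simp
      rw [this]
      have h5 : M * C / (M * C + 1) < 1 := by rw [div_lt_one (by positivity)]; linarith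
      nlinarith
    have h4 : ε / (2 * (2 * K + C + 1)) * (2 * K + C) ≤ ε / 2 := by
      have : ε / (2 * (2 * K + C + 1)) * (2 * K + C)
        = ε / 2 * ((2 * K + C) / (2 * K + C + 1)) := by field_simp
      rw [this]
      have h5 : (2 * K + C) / (2 * K + C + 1) ≤ 1 := by rw [div_le_one (by positivity)]; linarith
      nlinarith
    rw [abs_le] at h1 h2
    rw [abs_lt]
    constructor <;> linarith
  · have := (ContinuousMap.norm_coe_le_norm (P.toContinuousMapOn (Set.Icc 0 T) - x.1) s)
    rw [Real.norm_eq_abs] at this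
    rw [abs_sub_comm]
    exact this.trans hP.le

/-- A continuous function is Riemann–Stieltjes integrable against a function of bounded
variation. -/
lemma exists_hasRiemannStieltjesIntegral (hT : 0 < T) {f : Set.Icc (0 : ℝ) T → ℝ}
    (hf : BoundedVariationOn f Set.univ) (x : C0 T) :
    ∃ I, HasRiemannStieltjesIntegral f x I := by
  -- The approximant `J` depends on `ε`, so the actual integral is obtained as the limit along
  -- uniform partitions.
  have hcau : CauchySeq (unifSum hT f x.1) := by
    rw [Metric.cauchySeq_iff']
    intro ε hε
    obtain ⟨δ, hδ, J, hJ⟩ := exists_forall_rsSum_sub_le hT hf x (half_pos hε)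
    obtain ⟨N, hN⟩ := eventually_atTop.1 (eventually_isTaggedPartition_unifPt hT hδ)
    refine ⟨N, fun n hn => ?_⟩
    have h1 := hJ _ _ _ (hN n hn)
    have h2 := hJ _ _ _ (hN N le_rfl)
    rw [Real.dist_eq, unifSum, unifSum]
    rw [abs_lt] at *
    constructor <;> linarith
  obtain ⟨I, hI⟩ := cauchySeq_tendsto_of_complete hcau
  refine ⟨I, fun ε hε => ?_⟩
  obtain ⟨δ, hδ, J, hJ⟩ := exists_forall_rsSum_sub_le hT hf x (half_pos hε)
  refine ⟨δ, hδ, fun n t ξ h0 hn ht => ?_⟩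
  have h1 := hJ n t ξ ⟨h0, hn, ht⟩
  have h2 : |I - J| ≤ ε / 2 := by
    refine le_of_tendsto (hI.sub_const J).abs ?_
    filter_upwards [eventually_isTaggedPartition_unifPt hT hδ] with k hk
    exact (hJ _ _ _ hk).le
  change |rsSum f x.1 n t ξ - I| < ε
  rw [abs_le] at h2
  rw [abs_lt] at *
  constructor <;> linarith

/-- One explicit sequence of sums, continuous and linear in `x`, replaces the chosen value in
`riemannStieltjes`; linearity and measurability follow by passing to the limit. -/
lemma tendsto_unifSum (hT : 0 < T) {f : Set.Icc (0 : ℝ) T → ℝ}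
    (hf : BoundedVariationOn f Set.univ) (x : C0 T) :
    Tendsto (unifSum hT f x.1) atTop (𝓝 (riemannStieltjes f x)) := by
  have h := exists_hasRiemannStieltjesIntegral hT hf x
  rw [riemannStieltjes, dif_pos h]
  exact h.choose_spec.tendsto_unifSum hT

lemma riemannStieltjes_add_right (hT : 0 < T) {f : Set.Icc (0 : ℝ) T → ℝ}
    (hf : BoundedVariationOn f Set.univ) (x y : C0 T) :
    riemannStieltjes f (x + y) = riemannStieltjes f x + riemannStieltjes f y := by
  refine tendsto_nhds_unique (tendsto_unifSum hT hf (x + y))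
    (((tendsto_unifSum hT hf x).add (tendsto_unifSum hT hf y)).congr fun k => ?_)
  simp only [unifSum, rsSum, ← Finset.sum_add_distrib]
  exact Finset.sum_congr rfl fun i _ => by simp; ring

lemma riemannStieltjes_smul_right (hT : 0 < T) {f : Set.Icc (0 : ℝ) T → ℝ}
    (hf : BoundedVariationOn f Set.univ) (c : ℝ) (x : C0 T) :
    riemannStieltjes f (c • x) = c * riemannStieltjes f x := by
  refine tendsto_nhds_unique (tendsto_unifSum hT hf (c • x))
    (((tendsto_unifSum hT hf x).const_mul c).congr fun k => ?_)
  simp only [unifSum, rsSum, Finset.mul_sum]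
  exact Finset.sum_congr rfl fun i _ => by simp; ring

lemma continuous_unifSum (hT : 0 < T) (f : Set.Icc (0 : ℝ) T → ℝ) (k : ℕ) :
    Continuous fun x : C0 T => unifSum hT f x.1 k := by
  unfold unifSum rsSum
  have h : ∀ s, Continuous fun x : C0 T => x.1 s := fun s =>
    (continuous_eval_const s).comp continuous_subtype_val
  exact continuous_finsetSum _ fun i _ => continuous_const.mul ((h _).sub (h _))

lemma measurable_riemannStieltjes (hT : 0 < T) {f : Set.Icc (0 : ℝ) T → ℝ}
    (hf : BoundedVariationOn f Set.univ) :
    Measurable fun x : C0 T => riemannStieltjes f x :=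
  measurable_of_tendsto_metrizable (fun k => (continuous_unifSum hT f k).measurable)
    (tendsto_pi_nhds.2 fun x => tendsto_unifSum hT hf x)

/-- The Riemann sums of a function of bounded variation converge to its Lebesgue integral. -/
lemma tendsto_riemannSum (hT : 0 < T) {f : Set.Icc (0 : ℝ) T → ℝ}
    (hf : BoundedVariationOn f Set.univ) :
    Tendsto (unifSum hT f fun s => s) atTop (𝓝 (∫ s, f s ∂lebesgueIcc T)) := by
  obtain ⟨W, hW, hfW⟩ := hf.exists_monotone_majorant
  set C := W ⟨T, ⟨hT.le, le_rfl⟩⟩ - W ⟨0, ⟨le_rfl, hT.le⟩⟩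
  have hC : ∀ s t, W s - W t ≤ C := fun s t => by
    have h1 : W s ≤ W ⟨T, ⟨hT.le, le_rfl⟩⟩ := hW s.2.2
    have h2 : W ⟨0, ⟨le_rfl, hT.le⟩⟩ ≤ W t := hW t.2.1
    linarith
  have hC0 : 0 ≤ C := by simpa using hC ⟨0, ⟨le_rfl, hT.le⟩⟩ ⟨0, ⟨le_rfl, hT.le⟩⟩
  have hint : ∫ s, f s ∂lebesgueIcc T
      = ∫ s in (0 : ℝ)..T, f (Set.projIcc 0 T hT.le s) * 1 := by
    rw [intervalIntegral.integral_of_le hT.le, ← integral_Icc_eq_integral_Ioc,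
      ← integral_subtype_comap measurableSet_Icc]
    exact integral_congr_ae (Eventually.of_forall fun s => by simp [Set.projIcc_val])
  rw [hint, Metric.tendsto_nhds]
  intro ε hε
  filter_upwards [eventually_isTaggedPartition_unifPt hT
    (show 0 < ε / (C + 1) by positivity)] with k hk
  -- The integrator is the identity, whose derivative is bounded by `M = 1`.
  have := rsSum_sub_integral_le (g := fun s => s) (g' := fun _ => 1) (M := 1) hT hW hfW
    (fun s => hasDerivAt_id' s) continuous_const (by simp) hC hk
  rw [Real.dist_eq]
  refine this.trans_lt ?_
  rw [one_mul, div_mul_eq_mul_div, div_lt_iff₀ (by positivity)]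
  nlinarith

end RiemannStieltjes

/-! ### Characteristic functions and standard normal families. -/

section StandardNormal

variable {Ω : Type*} [MeasurableSpace Ω] {P : Measure Ω} [IsProbabilityMeasure P]

/-- Convergence of real random variables almost surely implies convergence of the values of their
characteristic functions. -/
lemma tendsto_integral_cexp {X : ℕ → Ω → ℝ} {Y : Ω → ℝ} (hX : ∀ n, Measurable (X n))
    (h : ∀ᵐ ω ∂P, Tendsto (fun n => X n ω) atTop (𝓝 (Y ω))) :
    Tendsto (fun n => ∫ ω, Complex.exp (X n ω * Complex.I) ∂P) atTop
      (𝓝 (∫ ω, Complex.exp (Y ω * Complex.I) ∂P)) := by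
  refine tendsto_integral_of_dominated_convergence (fun _ => 1)
    (fun n => by have := hX n; fun_prop) (integrable_const _) (fun n => ?_) ?_
  · exact Eventually.of_forall fun ω => (Complex.norm_exp_ofReal_mul_I _).le
  · filter_upwards [h] with ω hω
    exact (Complex.continuous_exp.tendsto _).comp
      (((Complex.continuous_ofReal.tendsto _).comp hω).mul_const _)

/-- A random vector all of whose linear combinations have the characteristic function of a
standard normal vector is a standard normal vector. -/
lemma map_eq_pi_gaussianReal {ι : Type*} [Fintype ι] {X : ι → Ω → ℝ} (hX : ∀ i, Measurable (X i))
    (h : ∀ a : ι → ℝ, ∫ ω, Complex.exp ((∑ i, a i * X i ω : ℝ) * Complex.I) ∂P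
      = Complex.exp ((-(∑ i, a i ^ 2) / 2 : ℝ))) :
    P.map (fun ω i => X i ω) = Measure.pi fun _ => gaussianReal 0 1 := by
  have hm : Measurable fun ω i => X i ω := measurable_pi_lambda _ hX
  have : IsProbabilityMeasure (P.map fun ω i => X i ω) :=
    Measure.isProbabilityMeasure_map hm.aemeasurable
  rw [← charFun_eq_pi_iff]
  intro t
  rw [Measure.map_map (by fun_prop) hm, charFun_apply, integral_map (by fun_prop) (by fun_prop)]
  have h1 := h t.ofLp
  simp only [charFun_gaussianReal, ← Complex.exp_sum]
  convert h1 using 3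
  · simp [PiLp.inner_apply]
  · push_cast
    simp [Finset.sum_div, neg_div]

/-- Independence is a property of finite subfamilies, and for each of these the characteristic
function determines the joint law as a product. -/
lemma iIndepFun_of_integral_cexp {ι : Type*} {X : ι → Ω → ℝ} (hX : ∀ i, Measurable (X i))
    (h : ∀ (s : Finset ι) (a : ι → ℝ),
      ∫ ω, Complex.exp ((∑ i ∈ s, a i * X i ω : ℝ) * Complex.I) ∂P
        = Complex.exp ((-(∑ i ∈ s, a i ^ 2) / 2 : ℝ))) :
    iIndepFun X P ∧ ∀ i, P.map (X i) = gaussianReal 0 1 := by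
  classical
  have hlaw : ∀ i, P.map (X i) = gaussianReal 0 1 := by
    intro i
    have := Measure.isProbabilityMeasure_map (μ := P) (hX i).aemeasurable
    refine Measure.ext_of_charFun ?_
    ext t
    rw [charFun_apply_real, integral_map (hX i).aemeasurable (by fun_prop), charFun_gaussianReal]
    have := h {i} fun _ => t
    simp only [Finset.sum_singleton] at this
    push_cast at this ⊢
    rw [this]
    congr 1
    simp [neg_div]
  refine ⟨?_, hlaw⟩
  rw [iIndepFun_iff_finset]
  intro s
  change iIndepFun (fun i : s => X i) P
  rw [iIndepFun_iff_map_fun_eq_pi_map fun i : s => (hX i).aemeasurable]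
  simp only [hlaw]
  refine map_eq_pi_gaussianReal (fun i => hX i) fun a => ?_
  -- Coefficients on `s` are extended by zero to the whole index set.
  have h1 := h s fun i => if hi : i ∈ s then a ⟨i, hi⟩ else 0
  simp_rw [← Finset.sum_coe_sort s, Finset.coe_mem, dite_true, Subtype.coe_eta] at h1
  exact h1

end StandardNormal

/-! ### Joint law of the integrals of the basis functions. -/

section Wiener

variable {T : ℝ} {m : Measure (C0 T)}

lemma IsWienerMeasure.isProbabilityMeasure (hm : IsWienerMeasure m) : IsProbabilityMeasure m :=
  hm.isGaussianProcess.isProbabilityMeasure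

lemma IsWienerMeasure.memLp_eval (hm : IsWienerMeasure m) (t : Set.Icc (0 : ℝ) T) :
    MemLp (fun x : C0 T => x.1 t) 2 m :=
  (hm.isGaussianProcess.hasGaussianLaw_eval t).memLp_two

lemma IsWienerMeasure.cov_eval (hm : IsWienerMeasure m) (s t : Set.Icc (0 : ℝ) T) :
    cov[fun x : C0 T => x.1 s, fun x : C0 T => x.1 t; m] = min (s : ℝ) t := by
  have := hm.isProbabilityMeasure
  rw [covariance_eq_sub (hm.memLp_eval s) (hm.memLp_eval t), hm.mean_eq_zero s, zero_mul, sub_zero]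
  exact hm.covariance_eq s t

/-- The sums of a function against Wiener increments are centered normal. -/
lemma IsWienerMeasure.integral_cexp_increments (hm : IsWienerMeasure m) (c : ℕ → ℝ) (n : ℕ)
    (t : ℕ → Set.Icc (0 : ℝ) T) (ht : MonotoneOn t (Set.Iic n)) :
    ∫ x : C0 T, Complex.exp
        ((∑ i ∈ Finset.range n, c i * (x.1 (t (i + 1)) - x.1 (t i)) : ℝ) * Complex.I) ∂m
      = Complex.exp ((-(∑ i ∈ Finset.range n, c i ^ 2 * ((t (i + 1) : ℝ) - t i)) / 2 : ℝ)) := by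
  have := hm.isProbabilityMeasure
  have hmono : ∀ i j, i ≤ j → j ≤ n → (t i : ℝ) ≤ t j := fun i j hij hj =>
    ht (Set.mem_Iic.2 (hij.trans hj)) (Set.mem_Iic.2 hj) hij
  have hd : ∀ i, MemLp (fun x : C0 T => x.1 (t (i + 1)) - x.1 (t i)) 2 m := fun i =>
    (hm.memLp_eval _).sub (hm.memLp_eval _)
  set X : C0 T → ℝ := fun x => ∑ i ∈ Finset.range n, c i * (x.1 (t (i + 1)) - x.1 (t i)) with hX
  -- A linear image of the Gaussian vector of increments is Gaussian, so only its mean and variance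
  -- remain to be found.
  have hg : HasGaussianLaw X m := by
    have h := (hm.isGaussianProcess.hasGaussianLaw_increments (n := n)
      (t := fun i => t i)).map_fun (∑ i : Fin n, c i • ContinuousLinearMap.proj (R := ℝ) i)
    refine h.congr (Eventually.of_forall fun x => ?_)
    simp [hX, ← Fin.sum_univ_eq_sum_range (fun i => c i * (x.1 (t (i + 1)) - x.1 (t i))) n]
  have hmean : ∫ x, X x ∂m = 0 := by
    rw [integral_finsetSum _ fun i _ => ((hd i).integrable one_le_two).const_mul _]
    refine Finset.sum_eq_zero fun i _ => ?_
    rw [integral_const_mul, integral_sub ((hm.memLp_eval _).integrable one_le_two)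
      ((hm.memLp_eval _).integrable one_le_two), hm.mean_eq_zero, hm.mean_eq_zero]
    simp
  -- Increments over distinct cells are uncorrelated: the four minima in the covariance cancel.
  have hcov : ∀ i < n, ∀ j < n, cov[fun x : C0 T => x.1 (t (i + 1)) - x.1 (t i),
      fun x : C0 T => x.1 (t (j + 1)) - x.1 (t j); m]
        = if i = j then (t (i + 1) : ℝ) - t i else 0 := by
    intro i hi j hj
    rw [covariance_fun_sub_left (hm.memLp_eval _) (hm.memLp_eval _) (hd j),
      covariance_fun_sub_right (hm.memLp_eval _) (hm.memLp_eval _) (hm.memLp_eval _),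
      covariance_fun_sub_right (hm.memLp_eval _) (hm.memLp_eval _) (hm.memLp_eval _),
      hm.cov_eval, hm.cov_eval, hm.cov_eval, hm.cov_eval]
    have h1 := hmono i (i + 1) (by omega) (by omega)
    have h2 := hmono j (j + 1) (by omega) (by omega)
    rcases lt_trichotomy i j with hij | rfl | hij
    · have h3 := hmono (i + 1) j (by omega) (by omega)
      rw [if_neg hij.ne, min_eq_left (h3.trans h2), min_eq_left h3,
        min_eq_left (h1.trans (h3.trans h2)), min_eq_left (h1.trans h3)]
      ring
    · rw [if_pos rfl, min_self, min_self, min_eq_right h1, min_eq_left h1]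
      ring
    · have h3 := hmono (j + 1) i (by omega) (by omega)
      rw [if_neg hij.ne', min_eq_right (h3.trans h1), min_eq_right h3,
        min_eq_right (h2.trans (h3.trans h1)), min_eq_right (h2.trans h3)]
      ring
  have hvar : Var[X; m] = ∑ i ∈ Finset.range n, c i ^ 2 * ((t (i + 1) : ℝ) - t i) := by
    rw [hX, variance_fun_sum' fun i _ => (hd i).const_mul (c i)]
    refine Finset.sum_congr rfl fun i hi => ?_
    rw [Finset.sum_eq_single_of_mem i hi fun j hj hji => ?_]
    · rw [covariance_const_mul_left, covariance_const_mul_right,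
        hcov i (Finset.mem_range.1 hi) i (Finset.mem_range.1 hi), if_pos rfl]
      ring
    · rw [covariance_const_mul_left, covariance_const_mul_right,
        hcov i (Finset.mem_range.1 hi) j (Finset.mem_range.1 hj), if_neg hji.symm]
      ring
  have h1 : charFun (m.map X) 1 = ∫ x, Complex.exp ((X x : ℝ) * Complex.I) ∂m := by
    rw [charFun_apply_real, integral_map hg.aemeasurable (by fun_prop)]
    simp
  rw [← h1, hg.map_eq_gaussianReal, charFun_gaussianReal, hmean, Real.coe_toNNReal _
    (variance_nonneg _ _), hvar]
  congr 1
  push_cast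
  ring

/-- This carries orthonormality from `L2` classes to the representatives, at whose point values the
Riemann sums are formed. -/
lemma BVBasis.integral_mul (φ : BVBasis T) (k l : ℕ) :
    ∫ s, φ.fn k s * φ.fn l s ∂lebesgueIcc T = if k = l then 1 else 0 := by
  have h := orthonormal_iff_ite.1 φ.basis.orthonormal k l
  rw [← h, L2.inner_def]
  refine integral_congr_ae ?_
  filter_upwards [φ.fn_ae_eq k, φ.fn_ae_eq l] with s hk hl
  rw [hk, hl, RCLike.inner_apply, conj_trivial, mul_comm]

/-- The integrals `∫ φₖ dx` are jointly standard normal. -/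
lemma IsWienerMeasure.integral_cexp_riemannStieltjes (hT : 0 < T) (hm : IsWienerMeasure m)
    (φ : BVBasis T) (s : Finset ℕ) (a : ℕ → ℝ) :
    ∫ x : C0 T, Complex.exp
        ((∑ k ∈ s, a k * riemannStieltjes (φ.fn k) x : ℝ) * Complex.I) ∂m
      = Complex.exp ((-(∑ k ∈ s, a k ^ 2) / 2 : ℝ)) := by
  have := hm.isProbabilityMeasure
  have h1 : Tendsto (fun j => ∫ x : C0 T, Complex.exp
        ((∑ k ∈ s, a k * unifSum hT (φ.fn k) x.1 j : ℝ) * Complex.I) ∂m) atTop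
      (𝓝 (∫ x : C0 T, Complex.exp
        ((∑ k ∈ s, a k * riemannStieltjes (φ.fn k) x : ℝ) * Complex.I) ∂m)) := by
    refine tendsto_integral_cexp (fun j => ?_) (Eventually.of_forall fun x => ?_)
    · exact Finset.measurable_fun_sum _ fun k _ =>
        ((continuous_unifSum hT (φ.fn k) j).measurable).const_mul _
    · exact tendsto_finsetSum _ fun k _ => (tendsto_unifSum hT (φ.fn_bv k) x).const_mul _
  refine tendsto_nhds_unique h1 ?_
  have h2 : Tendsto (fun j => ∑ k ∈ s, ∑ l ∈ s,
      a k * a l * unifSum hT (φ.fn k * φ.fn l) (fun t => t) j) atTop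
      (𝓝 (∑ k ∈ s, ∑ l ∈ s, a k * a l * if k = l then 1 else 0)) := by
    refine tendsto_finsetSum _ fun k _ => tendsto_finsetSum _ fun l _ => Tendsto.const_mul _ ?_
    rw [← φ.integral_mul k l]
    exact tendsto_riemannSum hT ((φ.fn_bv k).mul (φ.fn_bv l))
  have h3 : ∑ k ∈ s, ∑ l ∈ s, (a k * a l * if k = l then 1 else 0) = ∑ k ∈ s, a k ^ 2 := by
    refine Finset.sum_congr rfl fun k hk => ?_
    simp [hk, pow_two]
  rw [h3] at h2
  have h4 := (Complex.continuous_exp.tendsto _).comp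
    ((Complex.continuous_ofReal.tendsto _).comp (h2.neg.div_const 2))
  refine h4.congr fun j => ?_
  have h5 : ∀ x : C0 T, ∑ k ∈ s, a k * unifSum hT (φ.fn k) x.1 j
      = ∑ i ∈ Finset.range (j + 1), (∑ k ∈ s, a k * φ.fn k (unifPt hT j i))
        * (x.1 (unifPt hT j (i + 1)) - x.1 (unifPt hT j i)) := by
    intro x
    simp only [unifSum, rsSum, Finset.mul_sum, Finset.sum_mul]
    rw [Finset.sum_comm]
    simp only [mul_assoc]
  -- The double sum of Riemann sums is the variance of the discretised combination in `h5`.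
  have h6 : ∑ k ∈ s, ∑ l ∈ s, a k * a l * unifSum hT (φ.fn k * φ.fn l) (fun t => t) j
      = ∑ i ∈ Finset.range (j + 1), (∑ k ∈ s, a k * φ.fn k (unifPt hT j i)) ^ 2
        * ((unifPt hT j (i + 1) : ℝ) - unifPt hT j i) := by
    simp only [unifSum, rsSum, pow_two, Finset.mul_sum, Finset.sum_mul]
    conv_rhs => rw [Finset.sum_comm]
    refine Finset.sum_congr rfl fun k _ => ?_
    rw [Finset.sum_comm]
    refine Finset.sum_congr rfl fun i _ => Finset.sum_congr rfl fun l _ => ?_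
    simp only [Pi.mul_apply]; ring
  simp only [Function.comp_apply, h5, h6]
  refine (hm.integral_cexp_increments _ _ _ fun i hi j hj hij => ?_).symm
  rw [← Subtype.coe_le_coe, coe_unifPt hT hi, coe_unifPt hT hj]
  gcongr

lemma IsWienerMeasure.riemannStieltjes_iIndepFun (hT : 0 < T) (hm : IsWienerMeasure m)
    (φ : BVBasis T) :
    iIndepFun (fun k x => riemannStieltjes (φ.fn k) x) m ∧
      ∀ k, m.map (fun x => riemannStieltjes (φ.fn k) x) = gaussianReal 0 1 :=
  have := hm.isProbabilityMeasure
  iIndepFun_of_integral_cexp (fun k => measurable_riemannStieltjes hT (φ.fn_bv k))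
    (hm.integral_cexp_riemannStieltjes hT φ)

end Wiener

/-! ### Almost sure convergence of Gaussian series. -/

section Series

variable {Ω : Type*} [MeasurableSpace Ω] {P : Measure Ω} [IsProbabilityMeasure P]

/-- A square-summable series of independent standard normal variables converges almost surely. -/
lemma ae_exists_tendsto_sum_gaussian {ξ : ℕ → Ω → ℝ} (hξ : ∀ k, Measurable (ξ k))
    (hind : iIndepFun ξ P) (hlaw : ∀ k, P.map (ξ k) = gaussianReal 0 1) {c : ℕ → ℝ}
    (hc : Summable fun k => c k ^ 2) :
    ∀ᵐ ω ∂P, ∃ l, Tendsto (fun n => ∑ k ∈ Finset.range n, c k * ξ k ω) atTop (𝓝 l) := by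
  have hG : ∀ k, HasGaussianLaw (ξ k) P := fun k => ⟨by rw [hlaw k]; infer_instance⟩
  have hL2 : ∀ k, MemLp (ξ k) 2 P := fun k => (hG k).memLp_two
  have hmean : ∀ k, ∫ ω, ξ k ω ∂P = 0 := fun k => by
    have := integral_map (μ := P) (hξ k).aemeasurable (f := fun x : ℝ => x) (by fun_prop)
    rw [← this, hlaw k]; simp
  have hvar : ∀ k, Var[ξ k; P] = 1 := fun k => by
    have := variance_map (μ := P) (X := id) (Y := ξ k) (by fun_prop) (hξ k).aemeasurable
    rw [hlaw k] at this
    simpa using this.symm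
  have hcξ : ∀ k, MemLp (fun ω => c k * ξ k ω) 2 P := fun k => (hL2 k).const_mul _
  -- With `n + 1` terms, `S n` is measurable for the natural filtration at time `n`, and the next
  -- increment is independent of that σ-algebra. The shift is undone at the end.
  set S : ℕ → Ω → ℝ := fun n ω => ∑ k ∈ Finset.range (n + 1), c k * ξ k ω with hS
  have hSL2 : ∀ n, MemLp (S n) 2 P := fun n => memLp_finsetSum _ fun k _ => hcξ k
  have hsm : ∀ k, StronglyMeasurable (ξ k) := fun k => (hξ k).stronglyMeasurable
  have hSad : StronglyAdapted (Filtration.natural ξ hsm) S := by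
    intro n
    refine Finset.stronglyMeasurable_fun_sum _ fun k hk => ?_
    have hk' : k ≤ n := by have := Finset.mem_range.1 hk; omega
    exact ((Filtration.stronglyAdapted_natural hsm k).mono
      ((Filtration.natural ξ hsm).mono hk')).const_mul _
  have hmart : Martingale S (Filtration.natural ξ hsm) P := by
    refine martingale_nat hSad (fun n => (hSL2 n).integrable one_le_two) fun n => ?_
    have h1 : S (n + 1) = S n + c (n + 1) • ξ (n + 1) := by
      ext ω; simp [hS, Finset.sum_range_succ _ (n + 1)]
    rw [h1]
    have h2 := condExp_add ((hSL2 n).integrable one_le_two)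
      (((hL2 (n + 1)).integrable one_le_two).smul (c (n + 1))) (Filtration.natural ξ hsm n)
    have h3 := condExp_smul (μ := P) (c (n + 1)) (ξ (n + 1)) (Filtration.natural ξ hsm n)
    have h4 := hind.condExp_natural_ae_eq_of_lt hsm (Nat.lt_succ_self n)
    rw [condExp_of_stronglyMeasurable _ (hSad n) ((hSL2 n).integrable one_le_two)] at h2
    filter_upwards [h2, h3, h4] with ω w2 w3 w4
    rw [w2, Pi.add_apply, w3, Pi.smul_apply, w4, hmean]
    simp
  -- Since `|S| ≤ 1 + S²`, an `L²` bound suffices; by independence the variance is a partial sum of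
  -- `∑ c k ^ 2`.
  have hbdd : ∀ n, eLpNorm (S n) 1 P ≤ (Real.toNNReal (1 + ∑' k, c k ^ 2) : NNReal) := by
    intro n
    have hE : ∫ ω, S n ω ^ 2 ∂P ≤ ∑' k, c k ^ 2 := by
      have h0 : ∫ ω, S n ω ∂P = 0 := by
        rw [integral_finsetSum _ fun k _ => (hcξ k).integrable one_le_two]
        exact Finset.sum_eq_zero fun k _ => by rw [integral_const_mul, hmean, mul_zero]
      rw [← variance_of_integral_eq_zero (hSL2 n).aestronglyMeasurable.aemeasurable h0]
      have h1 := IndepFun.variance_sum (X := fun k ω => c k * ξ k ω) (μ := P)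
        (s := Finset.range (n + 1)) (fun k _ => hcξ k) fun i _ j _ hij =>
          (hind.indepFun hij).comp (measurable_const_mul (c i)) (measurable_const_mul (c j))
      have h2 : S n = ∑ k ∈ Finset.range (n + 1), fun ω => c k * ξ k ω := by
        ext ω; simp [hS]
      rw [h2, h1]
      simp only [variance_const_mul, hvar, mul_one]
      exact hc.sum_le_tsum _ fun k _ => sq_nonneg _
    have hint := (hSL2 n).integrable one_le_two
    rw [eLpNorm_one_eq_lintegral_enorm, ← ofReal_integral_norm_eq_lintegral_enorm hint]
    refine ENNReal.ofReal_le_ofReal ?_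
    calc ∫ ω, ‖S n ω‖ ∂P ≤ ∫ ω, (1 + S n ω ^ 2) ∂P := by
          refine integral_mono hint.norm ((integrable_const _).add (hSL2 n).integrable_sq) fun ω => ?_
          change |S n ω| ≤ 1 + S n ω ^ 2
          nlinarith [sq_abs (S n ω), sq_nonneg (|S n ω| - 1), abs_nonneg (S n ω)]
      _ = 1 + ∫ ω, S n ω ^ 2 ∂P := by
          rw [integral_add (integrable_const _) (hSL2 n).integrable_sq]; simp
      _ ≤ _ := by gcongr
  filter_upwards [hmart.submartingale.exists_ae_tendsto_of_bdd hbdd] with ω ⟨l, hl⟩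
  exact ⟨l, (tendsto_add_atTop_iff_nat 1).1 hl⟩

end Series

/-! ### The Paley–Wiener–Zygmund integral and its law. -/

section PWZ

variable {T : ℝ} {m : Measure (C0 T)} {φ : BVBasis T} {v : L2 T} {x y : C0 T}

/-- The set of paths at which the Paley–Wiener–Zygmund integral of `v` converges. -/
def pwzDomain (φ : BVBasis T) (v : L2 T) : Set (C0 T) := {x | ∃ c, HasPWZIntegral φ v x c}

lemma hasPWZIntegral_pwz (hx : x ∈ pwzDomain φ v) : HasPWZIntegral φ v x (pwz φ v x) := by
  have h : ∃ c, HasPWZIntegral φ v x c := hx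
  rw [pwz, dif_pos h]
  exact h.choose_spec

lemma HasPWZIntegral.pwz_eq {c : ℝ} (h : HasPWZIntegral φ v x c) : pwz φ v x = c :=
  tendsto_nhds_unique (hasPWZIntegral_pwz ⟨c, h⟩) h

lemma HasPWZIntegral.add (hT : 0 < T) {a b : ℝ} (hx : HasPWZIntegral φ v x a)
    (hy : HasPWZIntegral φ v y b) : HasPWZIntegral φ v (x + y) (a + b) := by
  refine (Tendsto.add hx hy).congr fun n => ?_
  rw [← Finset.sum_add_distrib]
  exact Finset.sum_congr rfl fun k _ => by rw [riemannStieltjes_add_right hT (φ.fn_bv k)]; ring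

lemma HasPWZIntegral.smul (hT : 0 < T) {a : ℝ} (r : ℝ) (hx : HasPWZIntegral φ v x a) :
    HasPWZIntegral φ v (r • x) (r * a) := by
  refine (Tendsto.const_mul r hx).congr fun n => ?_
  rw [Finset.mul_sum]
  exact Finset.sum_congr rfl fun k _ => by rw [riemannStieltjes_smul_right hT (φ.fn_bv k)]; ring

/-- Scale invariance of the domain makes a single null exceptional set null at every scale. -/
lemma smul_mem_pwzDomain_iff (hT : 0 < T) {r : ℝ} (hr : r ≠ 0) :
    r • x ∈ pwzDomain φ v ↔ x ∈ pwzDomain φ v := by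
  refine ⟨fun ⟨c, hc⟩ => ⟨r⁻¹ * c, ?_⟩, fun ⟨c, hc⟩ => ⟨r * c, hc.smul hT r⟩⟩
  simpa [smul_smul, hr] using hc.smul hT r⁻¹

lemma measurable_pwzSum (hT : 0 < T) (φ : BVBasis T) (v : L2 T) (n : ℕ) :
    Measurable fun x : C0 T => ∑ k ∈ Finset.range n,
      inner ℝ v (φ.basis k) * riemannStieltjes (φ.fn k) x :=
  Finset.measurable_fun_sum _ fun k _ => (measurable_riemannStieltjes hT (φ.fn_bv k)).const_mul _

lemma measurableSet_pwzDomain (hT : 0 < T) (φ : BVBasis T) (v : L2 T) :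
    MeasurableSet (pwzDomain φ v) :=
  measurableSet_exists_tendsto (measurable_pwzSum hT φ v)

lemma measurable_pwz (hT : 0 < T) (φ : BVBasis T) (v : L2 T) : Measurable (pwz φ v) := by
  classical
  have hD := measurableSet_pwzDomain hT φ v
  -- The partial sums cut off by the indicator converge everywhere, because `pwz` takes the value
  -- `0` off its domain.
  refine measurable_of_tendsto_metrizable (f := fun n => (pwzDomain φ v).indicator fun x : C0 T =>
    ∑ k ∈ Finset.range n, inner ℝ v (φ.basis k) * riemannStieltjes (φ.fn k) x)
    (fun n => (measurable_pwzSum hT φ v n).indicator hD) (tendsto_pi_nhds.2 fun x => ?_)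
  by_cases hx : x ∈ pwzDomain φ v
  · simp only [Set.indicator_of_mem hx]
    exact hasPWZIntegral_pwz hx
  · have : pwz φ v x = 0 := dif_neg hx
    simp [Set.indicator_of_notMem hx, this]

/-- Parseval's identity. It gives both the summability behind almost sure convergence and the
limiting variance. -/
lemma hasSum_inner_sq (φ : BVBasis T) (v : L2 T) :
    HasSum (fun k => inner ℝ v (φ.basis k) ^ 2) (‖v‖ ^ 2) := by
  have := φ.basis.hasSum_inner_mul_inner v v
  rw [real_inner_self_eq_norm_sq] at this
  refine this.congr_fun fun k => ?_
  rw [real_inner_comm v, pow_two]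

lemma IsWienerMeasure.ae_mem_pwzDomain (hT : 0 < T) (hm : IsWienerMeasure m) (φ : BVBasis T)
    (v : L2 T) : ∀ᵐ x ∂m, x ∈ pwzDomain φ v :=
  have := hm.isProbabilityMeasure
  have h := hm.riemannStieltjes_iIndepFun hT φ
  ae_exists_tendsto_sum_gaussian (fun k => measurable_riemannStieltjes hT (φ.fn_bv k)) h.1 h.2
    (hasSum_inner_sq φ v).summable

/-- The Paley–Wiener–Zygmund integrals of an orthonormal family are independent standard normal
variables. -/
lemma IsWienerMeasure.map_pwz (hT : 0 < T) (hm : IsWienerMeasure m) (φ : BVBasis T) {n : ℕ}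
    {α : Fin n → L2 T} (hα : Orthonormal ℝ α) :
    m.map (fun x j => pwz φ (α j) x) = Measure.pi fun _ => gaussianReal 0 1 := by
  have := hm.isProbabilityMeasure
  refine map_eq_pi_gaussianReal (fun j => measurable_pwz hT φ (α j)) fun a => ?_
  -- Almost surely `∑ aⱼ⟨αⱼ,x⟩` is the limit of the partial sums for `v`, and orthonormality gives
  -- the variance `‖v‖² = ∑ aⱼ²`.
  set v : L2 T := ∑ j, a j • α j with hv
  have hnorm : ‖v‖ ^ 2 = ∑ j, a j ^ 2 := by
    rw [← real_inner_self_eq_norm_sq, hv, hα.inner_sum]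
    simp [pow_two]
  have h1 := tendsto_integral_cexp (P := m) (measurable_pwzSum hT φ v)
    (Y := fun x => ∑ j, a j * pwz φ (α j) x) (by
      filter_upwards [ae_all_iff.2 fun j => hm.ae_mem_pwzDomain hT φ (α j)] with x hx
      refine (tendsto_finsetSum Finset.univ fun j _ =>
        (hasPWZIntegral_pwz (hx j)).const_mul (a j)).congr fun N => ?_
      simp only [Finset.mul_sum, hv, sum_inner, Finset.sum_mul, real_inner_smul_left]
      rw [Finset.sum_comm]
      simp only [mul_assoc])
  refine tendsto_nhds_unique h1 ?_
  simp only [hm.integral_cexp_riemannStieltjes hT φ]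
  rw [← hnorm]
  exact (Complex.continuous_exp.tendsto _).comp ((Complex.continuous_ofReal.tendsto _).comp
    ((hasSum_inner_sq φ v).tendsto_sum_nat.neg.div_const 2))

end PWZ

/-! ### Moments of shifted normal variables. -/

section GaussianMoments

lemma integrable_pow_gaussianReal (k : ℕ) :
    Integrable (fun x : ℝ => x ^ k) (gaussianReal 0 1) := by
  have h := (memLp_id_gaussianReal (μ := 0) (v := 1) (k : NNReal)).integrable_norm_pow'
  exact h.mono' (by fun_prop) (Eventually.of_forall fun x => by simp)

lemma integral_pow_odd_gaussianReal (s : ℕ) :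
    ∫ x : ℝ, x ^ (2 * s + 1) ∂gaussianReal 0 1 = 0 := by
  have h : ∫ x : ℝ, x ^ (2 * s + 1) ∂gaussianReal 0 1
      = ∫ x : ℝ, (-x) ^ (2 * s + 1) ∂gaussianReal 0 1 := by
    have h1 := gaussianReal_map_neg (μ := 0) (v := 1)
    rw [neg_zero] at h1
    conv_lhs => rw [← h1]
    exact integral_map (by fun_prop) (by fun_prop)
  simp only [Odd.neg_pow ⟨s, rfl⟩, integral_neg] at h
  linarith

/-- The even moments of the standard normal distribution. -/
lemma integral_pow_even_gaussianReal (s : ℕ) :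
    ∫ x : ℝ, x ^ (2 * s) ∂gaussianReal 0 1 = (Nat.doubleFactorial (2 * s - 1) : ℝ) := by
  -- Symmetry reduces the moment to a half-line integral, a value of `Γ` at `s + 1/2`. At `s = 0`
  -- truncated subtraction gives `0‼ = 1`, in agreement with `(-1)!! = 1`.
  rw [integral_gaussianReal_eq_integral_smul one_ne_zero]
  have h1 : ∀ x : ℝ, gaussianPDFReal 0 1 x • x ^ (2 * s)
      = (√(2 * Real.pi))⁻¹ * (|x| ^ (2 * s : ℝ) * Real.exp (-(1 / 2) * |x| ^ (2 : ℝ))) := by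
    intro x
    have h2 : |x| ^ (2 * s : ℝ) = x ^ (2 * s) := by
      rw [← Nat.cast_ofNat (n := 2), ← Nat.cast_mul, Real.rpow_natCast, pow_mul, sq_abs, ← pow_mul]
    have h3 : |x| ^ (2 : ℝ) = x ^ 2 := by rw [Real.rpow_two, sq_abs]
    rw [h2, h3, gaussianPDFReal, smul_eq_mul]
    simp only [NNReal.coe_one, mul_one, sub_zero]
    rw [mul_assoc, mul_comm (Real.exp _)]
    congr 3
    ring
  simp_rw [h1]
  rw [integral_const_mul, integral_comp_abs
      (f := fun x => x ^ (2 * s : ℝ) * Real.exp (-(1 / 2) * x ^ (2 : ℝ))),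
    integral_rpow_mul_exp_neg_mul_rpow two_pos (by have : (0 : ℝ) ≤ s := s.cast_nonneg; linarith)
      (by norm_num), show (2 * s + 1 : ℝ) / 2 = s + 1 / 2 by ring, Real.Gamma_nat_add_half,
    show (-(2 * s + 1) / 2 : ℝ) = -(s + 1 / 2) by ring, one_div, Real.inv_rpow two_pos.le,
    Real.rpow_neg two_pos.le, inv_inv, Real.rpow_add two_pos, Real.rpow_natCast,
    show (2 : ℝ) ^ (2⁻¹ : ℝ) = √2 by rw [Real.sqrt_eq_rpow, one_div], Real.sqrt_mul two_pos.le]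
  field_simp

lemma sum_range_odd_eq_zero {M : Type*} [AddCommMonoid M] (h : ℕ → M)
    (hodd : ∀ s, h (2 * s + 1) = 0) (p : ℕ) :
    ∑ k ∈ Finset.range (2 * p + 1), h k = ∑ s ∈ Finset.range (p + 1), h (2 * s) := by
  induction p with
  | zero => simp
  | succ p ih =>
    rw [Finset.sum_range_succ _ (p + 1), ← ih, show 2 * (p + 1) + 1 = 2 * p + 1 + 1 + 1 by ring,
      Finset.sum_range_succ, Finset.sum_range_succ, hodd, add_zero]
    rfl

/-- The expectation of `(a + √w g)^{2p}` for a standard normal variable `g`, as a polynomial in `a`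
and `w`. -/
noncomputable def gaussianShiftMoment (p : ℕ) (a w : ℂ) : ℂ :=
  ∑ s ∈ Finset.range (p + 1), ((2 * p).choose (2 * s) : ℂ) *
    (Nat.doubleFactorial (2 * s - 1) : ℂ) * w ^ s * a ^ (2 * p - 2 * s)

lemma integrable_shift_pow (p : ℕ) (a r : ℝ) :
    Integrable (fun x : ℝ => ((a + r * x : ℝ) : ℂ) ^ p) (gaussianReal 0 1) := by
  have h : Integrable (fun x : ℝ => (a + r * x) ^ p) (gaussianReal 0 1) := by
    simp only [add_comm a, add_pow, mul_pow]
    exact integrable_finsetSum _ fun k _ =>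
      (((integrable_pow_gaussianReal k).const_mul _).mul_const _).mul_const _
  simpa using h.ofReal (𝕜 := ℂ)

/-- In the binomial expansion the odd moments vanish, so only even powers of `r` survive. With `r =
λ^{-1/2}` the result is a polynomial in `λ⁻¹`, with no square root left to continue. -/
lemma integral_shift_pow (p : ℕ) (a r : ℝ) :
    ∫ x : ℝ, ((a + r * x : ℝ) : ℂ) ^ (2 * p) ∂gaussianReal 0 1
      = gaussianShiftMoment p a ((r ^ 2 : ℝ) : ℂ) := by
  have h : ∫ x : ℝ, (a + r * x) ^ (2 * p) ∂gaussianReal 0 1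
      = ∑ s ∈ Finset.range (p + 1), ((2 * p).choose (2 * s) : ℝ) *
        (Nat.doubleFactorial (2 * s - 1) : ℝ) * (r ^ 2) ^ s * a ^ (2 * p - 2 * s) := by
    simp only [add_comm a, add_pow, mul_pow]
    rw [integral_finsetSum _ fun k _ =>
      (((integrable_pow_gaussianReal k).const_mul _).mul_const _).mul_const _]
    simp only [integral_mul_const, integral_const_mul]
    rw [sum_range_odd_eq_zero]
    · refine Finset.sum_congr rfl fun s _ => ?_
      rw [integral_pow_even_gaussianReal]; ring
    · intro s
      rw [integral_pow_odd_gaussianReal]; ring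
  rw [gaussianShiftMoment]
  simp only [← Complex.ofReal_pow]
  rw [integral_complex_ofReal, h]
  push_cast
  rfl

end GaussianMoments

/-! ### Scale-invariant null sets and the analytic Wiener integral. -/

section Transform

variable {T : ℝ} {m : Measure (C0 T)}

lemma MeasurableSet.image_smul_C0 {s : Set (C0 T)} (hs : MeasurableSet s) {ρ : ℝ} (hρ : ρ ≠ 0) :
    MeasurableSet ((fun x : C0 T => ρ • x) '' s) :=
  (Homeomorph.smulOfNeZero ρ hρ).measurableEmbedding.measurableSet_image.2 hs

lemma Measurable.scaleInvMeasurable {F : C0 T → ℂ} (hF : Measurable F) : ScaleInvMeasurable m F :=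
  fun _ hs _ hρ => ((hF hs).image_smul_C0 hρ.ne').nullMeasurableSet

/-- Every dilate of the exceptional set lies in the set itself, which is Wiener null. -/
lemma IsWienerMeasure.scaleInvNull_compl_pwzDomain (hT : 0 < T) (hm : IsWienerMeasure m)
    (φ : BVBasis T) {n : ℕ} (α : Fin n → L2 T) :
    ScaleInvNull m {x | ∃ j, x ∉ pwzDomain φ (α j)} := by
  have hmeas : MeasurableSet {x | ∃ j, x ∉ pwzDomain φ (α j)} := by
    simp only [Set.ofPred_exists]
    exact .iUnion fun j => (measurableSet_pwzDomain hT φ (α j)).compl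
  refine ⟨fun ρ hρ => (hmeas.image_smul_C0 hρ.ne').nullMeasurableSet, fun ρ hρ => ?_⟩
  have h0 : m {x | ∃ j, x ∉ pwzDomain φ (α j)} = 0 := by
    have := ae_all_iff.2 fun j => hm.ae_mem_pwzDomain hT φ (α j)
    rw [ae_iff] at this
    simpa using this
  refine measure_mono_null ?_ h0
  rintro _ ⟨x, ⟨j, hj⟩, rfl⟩
  exact ⟨j, fun h => hj ((smul_mem_pwzDomain_iff hT hρ.ne').1 h)⟩

lemma measurable_polyFunctional (hT : 0 < T) (φ : BVBasis T) {n : ℕ} (α : Fin n → L2 T)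
    (p : Fin n → ℕ) : Measurable (polyFunctional φ α p) :=
  Finset.measurable_fun_prod _ fun j _ =>
    (Complex.measurable_ofReal.comp (measurable_pwz hT φ (α j))).pow_const _

/-- Both points must lie in the domains: the default value `0` would break additivity of `pwz`. -/
lemma polyFunctional_add_smul (hT : 0 < T) {φ : BVBasis T} {n : ℕ} {α : Fin n → L2 T}
    (p : Fin n → ℕ) {x y : C0 T} (hy : ∀ j, y ∈ pwzDomain φ (α j))
    (hx : ∀ j, x ∈ pwzDomain φ (α j)) (r : ℝ) :
    polyFunctional φ α p (y + r • x)
      = ∏ j, ((pwz φ (α j) y + r * pwz φ (α j) x : ℝ) : ℂ) ^ (2 * p j) := by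
  refine Finset.prod_congr rfl fun j _ => ?_
  rw [((hasPWZIntegral_pwz (hy j)).add hT ((hasPWZIntegral_pwz (hx j)).smul hT r)).pwz_eq]

/-- The analytic Wiener integral of `x ↦ F(y + x)`. -/
lemma IsWienerMeasure.isAnalyticWienerIntegral_polyFunctional (hT : 0 < T)
    (hm : IsWienerMeasure m) (φ : BVBasis T) {n : ℕ} {α : Fin n → L2 T} (hα : Orthonormal ℝ α)
    (p : Fin n → ℕ) {y : C0 T} (hy : ∀ j, y ∈ pwzDomain φ (α j)) :
    IsAnalyticWienerIntegral m (fun x => polyFunctional φ α p (y + x))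
      (fun l => ∏ j, gaussianShiftMoment (p j) (pwz φ (α j) y) l⁻¹) := by
  have hX : Measurable fun x j => pwz φ (α j) x :=
    measurable_pi_lambda _ fun j => measurable_pwz hT φ (α j)
  have hlaw := hm.map_pwz hT φ hα
  have hmeas : ∀ r : ℝ, Measurable fun z : Fin n → ℝ =>
      ∏ j, ((pwz φ (α j) y + r * z j : ℝ) : ℂ) ^ (2 * p j) := fun r =>
    Finset.measurable_fun_prod _ fun j _ =>
      (Complex.measurable_ofReal.comp (by fun_prop)).pow_const _
  -- Almost everywhere the integrand is a function of the vector of `pwz` values alone, so the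
  -- Wiener integral becomes one against a product Gaussian measure.
  have hae : ∀ r : ℝ, (fun x => polyFunctional φ α p (y + r • x)) =ᵐ[m]
      (fun z : Fin n → ℝ => ∏ j, ((pwz φ (α j) y + r * z j : ℝ) : ℂ) ^ (2 * p j)) ∘
        fun x j => pwz φ (α j) x := fun r => by
    filter_upwards [ae_all_iff.2 fun j => hm.ae_mem_pwzDomain hT φ (α j)] with x hx
    exact polyFunctional_add_smul hT p hy hx r
  refine ⟨?_, fun l hl => ?_, ?_, fun l hl => ?_⟩
  · exact ((measurable_polyFunctional hT φ α p).comp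
      (continuous_const_add y).measurable).scaleInvMeasurable
  · rw [integrable_congr (hae _), ← integrable_map_measure (hmeas _).aestronglyMeasurable hX.aemeasurable, hlaw]
    exact Integrable.fintype_prod fun j => integrable_shift_pow _ _ _
  · refine Finset.analyticOnNhd_fun_prod _ fun j _ => ?_
    refine Finset.analyticOnNhd_fun_sum _ fun s _ => ?_
    -- The only possible pole is `λ = 0`, which is outside `ℂ₊`.
    refine (analyticOnNhd_const.mul (AnalyticOnNhd.pow (analyticOnNhd_id.inv fun z hz => ?_) s)).mul
      analyticOnNhd_const
    rintro rfl
    simp [rightHalfPlane] at hz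
  · rw [integral_congr_ae (hae _)]
    simp only [Function.comp_def]
    rw [← integral_map (φ := fun x j => pwz φ (α j) x) (μ := m)
      (f := fun z : Fin n → ℝ => ∏ j, ((pwz φ (α j) y + (√l)⁻¹ * z j : ℝ) : ℂ) ^ (2 * p j))
      hX.aemeasurable (hmeas _).aestronglyMeasurable, hlaw, integral_fintype_prod_eq_prod
      (f := fun j (z : ℝ) => ((pwz φ (α j) y + (√l)⁻¹ * z : ℝ) : ℂ) ^ (2 * p j))]
    refine Finset.prod_congr rfl fun j _ => ?_
    rw [integral_shift_pow, inv_pow, Real.sq_sqrt hl.le, Complex.ofReal_inv]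

end Transform

theorem theorem2 (T : ℝ) (hT : 0 < T) (m : Measure (C0 T)) (hm : IsWienerMeasure m)
    (φ : BVBasis T) (n : ℕ) (α : Fin n → L2 T) (hα : Orthonormal ℝ α) (p : Fin n → ℕ)
    (q : ℝ) (hq : q ≠ 0) :
    HasL1FourierFeynmanTransform m q (polyFunctional φ α p)
      (fun y => ∏ j, ∑ s ∈ Finset.range (p j + 1),
        ((2 * p j).choose (2 * s) : ℂ) * (Nat.doubleFactorial (2 * s - 1) : ℂ)
          * (Complex.I / (q : ℂ)) ^ s * (pwz φ (α j) y : ℂ) ^ (2 * p j - 2 * s)) := by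
  refine ⟨_, hm.scaleInvNull_compl_pwzDomain hT φ α, fun y hy => ?_⟩
  have hy' : ∀ j, y ∈ pwzDomain φ (α j) := by simpa using hy
  refine ⟨_, hm.isAnalyticWienerIntegral_polyFunctional hT φ hα p hy', ?_⟩
  have hq' : (q : ℂ) ≠ 0 := Complex.ofReal_ne_zero.2 hq
  have hne : -Complex.I * (q : ℂ) ≠ 0 := mul_ne_zero (neg_ne_zero.2 Complex.I_ne_zero) hq'
  have hinv : (-Complex.I * (q : ℂ))⁻¹ = Complex.I / q := by
    rw [mul_inv, inv_neg, Complex.inv_I, neg_neg, div_eq_mul_inv]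
  have hlim : Tendsto (fun l : ℂ => l⁻¹) (𝓝[rightHalfPlane] (-Complex.I * (q : ℂ)))
      (𝓝 (Complex.I / q)) := by
    rw [← hinv]
    exact (tendsto_inv₀ hne).mono_left nhdsWithin_le_nhds
  -- The continuation is a polynomial in `λ⁻¹`, and `λ⁻¹` is continuous at the boundary point `-iq`
  -- because `q ≠ 0`.
  exact tendsto_finsetProd _ fun j _ => tendsto_finsetSum _ fun s _ =>
    ((hlim.pow s).const_mul _).mul_const _
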